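/- Consider the Bell scenario with two parties, two settings $x,y\in\{0,1\}$ and two outcomes $a,b\in\{0,1\}$ per setting; a correlation is a table $\vec P=(P(a,b|x,y))$. Let $\mathcal L$ be the convex hull of the 16 local deterministic correlations $P(a,b|x,y)=\delta_{a,f(x)}\delta_{b,g(y)}$ ($f,g:\{0,1\}\to\{0,1\}$); a correlation outside $\mathcal L$ is called nonlocal. Let $\mathcal Q$ be the set of correlations $P(a,b|x,y)=\mathrm{tr}[(M^A_{a|x}\otimes M^B_{b|y})\rho]$, where $\rho$ is a density operator on a tensor product of two Hilbert spaces of arbitrary dimension and $\{M^A_{a|x}\}_a$, $\{M^B_{b|y}\}_b$ are local POVMs. For $2\le d<\infty$ let $\mathcal M_d$ be the convex hull of the correlations obtained in this way from $\rho=|\Phi_d^+\rangle\langle\Phi_d^+|$, $|\Phi^+_d\rangle=\frac1{\sqrt d}\sum_{i=0}^{d-1}|i\rangle|i\rangle\in\mathbb C^d\otimes\mathbb C^d$, and let $\mathcal M$ be the convex hull of $\bigcup_{d\ge2}\mathcal M_d$. Define \begin{align*} \mathcal Q_{2b}&=\{\vec P\in\mathcal Q: P(0,0|0,0)=P(1,1|1,0)=0\},\\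 \mathcal Q_{2c}&=\{\vec P\in\mathcal Q: P(0,0|0,0)=P(1,0|1,1)=0\},\\ \mathcal Q_{3a}&=\{\vec P\in\mathcal Q: P(0,0|0,0)=P(1,1|1,0)=P(1,1|0,1)=0\},\\ \mathcal Q_{3b}&=\{\vec P\in\mathcal Q: P(0,0|0,0)=P(1,1|0,0)=P(1,0|1,1)=0\}. \end{align*} Theorem. No nonlocal correlation in $\mathcal Q_{2b}$ or $\mathcal Q_{2c}$, and hence none in $\mathcal Q_{3a}$ or $\mathcal Q_{3b}$, arises from finite-dimensional maximally entangled states: if $\vec P\notin\mathcal L$ belongs to one of these four sets, then $\vec P\notin\mathcal M$. The same holds if $\vec P$ belongs to one of these sets only after a relabeling of the settings of either party, of the outcomes of either party (depending on that party's setting), or of the two parties, or a combination of these. -/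

import Mathlib

open scoped InnerProductSpace TensorProduct Kronecker ComplexOrder

namespace CHSH

/-- A table of conditional probabilities of the two-party, two-setting, two-outcome scenario:
`P a b x y` is `P(a,b|x,y)`, with outcomes `a`, `b` and settings `x`, `y` in `{0,1}`. -/
abbrev Corr : Type := Fin 2 → Fin 2 → Fin 2 → Fin 2 → ℝ

/-! ### Bell-local correlations -/

/-- The local deterministic correlation in which Alice answers `f x` and Bob answers `g y`. -/
def localDeterministic (f g : Fin 2 → Fin 2) : Corr :=
  fun a b x y => if a = f x ∧ b = g y then 1 else 0

/-- The local (Bell) polytope: the convex hull of the 16 local deterministic correlations. -/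
def localSet : Set Corr :=
  convexHull ℝ (Set.range fun p : (Fin 2 → Fin 2) × (Fin 2 → Fin 2) =>
    localDeterministic p.1 p.2)

/-! ### Quantum correlations, with no restriction on the local Hilbert spaces -/

/-- `E x a` is the effect of outcome `a` of a two-outcome POVM with setting `x`. -/
def IsOperatorPOVM {H : Type} [NormedAddCommGroup H] [InnerProductSpace ℂ H]
    (E : Fin 2 → Fin 2 → H →L[ℂ] H) : Prop :=
  (∀ x a, (E x a).IsPositive) ∧ ∀ x, ∑ a, E x a = ContinuousLinearMap.id ℂ H

/-- The Hilbert space tensor product, that is, the completion of the algebraic one. -/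
abbrev HilbertTensor (H K : Type) [NormedAddCommGroup H] [InnerProductSpace ℂ H]
    [NormedAddCommGroup K] [InnerProductSpace ℂ K] : Type :=
  UniformSpace.Completion (H ⊗[ℂ] K)

/-- The bounded operator `S ⊗ T` on the Hilbert space tensor product. -/
noncomputable def tensorOp {H K : Type} [NormedAddCommGroup H] [InnerProductSpace ℂ H]
    [NormedAddCommGroup K] [InnerProductSpace ℂ K] (S : H →L[ℂ] H) (T : K →L[ℂ] K) :
    HilbertTensor H K →L[ℂ] HilbertTensor H K :=
  (TensorProduct.mapL S T).completion

/-- `T` has trace `t`: in every Hilbert basis, the diagonal entries of `T` sum to `t`. -/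
def HasTrace {H : Type} [NormedAddCommGroup H] [InnerProductSpace ℂ H]
    (T : H →L[ℂ] H) (t : ℂ) : Prop :=
  ∀ (ι : Type) (e : HilbertBasis ι ℂ H), HasSum (fun i => ⟪e i, T (e i)⟫_ℂ) t

/-- `ρ` is a density operator: positive with trace one. -/
def IsDensityOperator {H : Type} [NormedAddCommGroup H] [InnerProductSpace ℂ H]
    (ρ : H →L[ℂ] H) : Prop :=
  ρ.IsPositive ∧ HasTrace ρ 1

/-- The set of quantum correlations: those of the form
`P(a,b|x,y) = tr[(E_{a|x} ⊗ F_{b|y}) ρ]` for a density operator `ρ` on a tensor product of two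
Hilbert spaces, of any dimension, and local POVMs `E` and `F`. -/
def quantumSet : Set Corr :=
  {P | ∃ (H K : Type) (_ : NormedAddCommGroup H) (_ : InnerProductSpace ℂ H) (_ : CompleteSpace H)
      (_ : NormedAddCommGroup K) (_ : InnerProductSpace ℂ K) (_ : CompleteSpace K)
      (E : Fin 2 → Fin 2 → H →L[ℂ] H) (F : Fin 2 → Fin 2 → K →L[ℂ] K)
      (ρ : HilbertTensor H K →L[ℂ] HilbertTensor H K),
      IsOperatorPOVM E ∧ IsOperatorPOVM F ∧ IsDensityOperator ρ ∧
        ∀ a b x y, HasTrace (tensorOp (E x a) (F y b) ∘L ρ) (P a b x y : ℂ)}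

/-! ### Correlations of finite-dimensional maximally entangled states -/

/-- A two-outcome POVM for each setting, on the `d`-dimensional space `ℂ^d`. -/
def IsMatrixPOVM {d : ℕ} (E : Fin 2 → Fin 2 → Matrix (Fin d) (Fin d) ℂ) : Prop :=
  (∀ x a, (E x a).PosSemidef) ∧ ∀ x, ∑ a, E x a = 1

/-- The maximally entangled vector `d^{-1/2} ∑ i, |i⟩|i⟩` of `ℂ^d ⊗ ℂ^d`, in coordinates. -/
noncomputable def maxEntangledVec (d : ℕ) : Fin d × Fin d → ℂ :=
  fun p => if p.1 = p.2 then ((1 / Real.sqrt d : ℝ) : ℂ) else 0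

/-- The projector `|Φ⟩⟨Φ|` onto the maximally entangled vector. -/
noncomputable def maxEntangledState (d : ℕ) : Matrix (Fin d × Fin d) (Fin d × Fin d) ℂ :=
  Matrix.vecMulVec (maxEntangledVec d) (star (maxEntangledVec d))

/-- The correlations obtained from the maximally entangled state of local dimension `d` by local
POVMs, through Born's rule `P(a,b|x,y) = tr[(E_{a|x} ⊗ F_{b|y}) |Φ⟩⟨Φ|]`. -/
def maxEntangledCorr (d : ℕ) : Set Corr :=
  {P | ∃ E F : Fin 2 → Fin 2 → Matrix (Fin d) (Fin d) ℂ, IsMatrixPOVM E ∧ IsMatrixPOVM F ∧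
      ∀ a b x y, (P a b x y : ℂ) = ((E x a ⊗ₖ F y b) * maxEntangledState d).trace}

/-- The set `M_d`: the convex hull of the correlations attainable with local dimension `d`. -/
def maxEntangledSetOfDim (d : ℕ) : Set Corr :=
  convexHull ℝ (maxEntangledCorr d)

/-- The set `M`: the convex hull of the union of all `M_d`, `2 ≤ d < ∞`. -/
def maxEntangledSet : Set Corr :=
  convexHull ℝ (⋃ d ∈ Set.Ici (2 : ℕ), maxEntangledSetOfDim d)

/-! ### Boundary classes -/

/-- Quantum correlations with `P(0,0|0,0) = P(1,1|1,0) = 0`. -/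
def Q2b : Set Corr :=
  {P | P ∈ quantumSet ∧ P 0 0 0 0 = 0 ∧ P 1 1 1 0 = 0}

/-- Quantum correlations with `P(0,0|0,0) = P(1,0|1,1) = 0`. -/
def Q2c : Set Corr :=
  {P | P ∈ quantumSet ∧ P 0 0 0 0 = 0 ∧ P 1 0 1 1 = 0}

/-- Quantum correlations with `P(0,0|0,0) = P(1,1|1,0) = P(1,1|0,1) = 0`. -/
def Q3a : Set Corr :=
  {P | P ∈ quantumSet ∧ P 0 0 0 0 = 0 ∧ P 1 1 1 0 = 0 ∧ P 1 1 0 1 = 0}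

/-- Quantum correlations with `P(0,0|0,0) = P(1,1|0,0) = P(1,0|1,1) = 0`. -/
def Q3b : Set Corr :=
  {P | P ∈ quantumSet ∧ P 0 0 0 0 = 0 ∧ P 1 1 0 0 = 0 ∧ P 1 0 1 1 = 0}

/-- A relabeling: permutations of the settings of each party, for each setting a permutation of
the outcomes, and possibly an exchange of the two parties. -/
structure Relabeling where
  swapParties : Bool
  settingA : Equiv.Perm (Fin 2)
  settingB : Equiv.Perm (Fin 2)
  outcomeA : Fin 2 → Equiv.Perm (Fin 2)
  outcomeB : Fin 2 → Equiv.Perm (Fin 2)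

/-- The relabeled correlation. -/
def Relabeling.apply (r : Relabeling) (P : Corr) : Corr :=
  fun a b x y =>
    let a' := r.outcomeA x a
    let b' := r.outcomeB y b
    let x' := r.settingA x
    let y' := r.settingB y
    if r.swapParties then P b' a' y' x' else P a' b' x' y'

/-- The correlations that belong to `S` after a suitable relabeling. -/
def upToRelabeling (S : Set Corr) : Set Corr :=
  {P | ∃ r : Relabeling, r.apply P ∈ S}

end CHSH

namespace CHSH

/-! On a maximally entangled state Bob's effects move to Alice's side by transposition, so
P(a,b|x,y) = tr(E_{a|x} G_{b|y})/d. A zero entry then forces E G = 0, an operator identity on a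
single space, and orthogonality of effects becomes operator inequality: XY = 0 gives Y ≤ 1 - X
(`posSemidef_sub_of_mul_eq_zero`). With two zeros this yields inequalities between entries of P
which, together with no-signalling, allow an explicit local model (`mem_localSet_of_zeros_b`,
`mem_localSet_of_zeros_c`). Mixtures reduce to this case since the zeros cut out a face of the
convex hull, and relabelings preserve all the sets involved. The zeros of `Q3a` include those of
`Q2b`, and those of `Q3b` include those of `Q2c`. -/

/-! ### Explicit local models -/

theorem mem_localSet_of_sum {ι : Type*} [Fintype ι] (w : ι → ℝ) (f g : ι → Fin 2 → Fin 2)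
    (hw : ∀ i, 0 ≤ w i) (h1 : ∑ i, w i = 1) {P : Corr}
    (hP : ∀ a b x y, P a b x y = ∑ i, w i * localDeterministic (f i) (g i) a b x y) :
    P ∈ localSet := by
  have h : P = ∑ i, w i • localDeterministic (f i) (g i) := by
    funext a b x y
    simp [hP, Finset.sum_apply]
  rw [h]
  exact (convex_convexHull ℝ _).sum_mem (fun i _ => hw i) h1
    fun i _ => subset_convexHull ℝ _ ⟨(f i, g i), rfl⟩

/-- Nonnegative, normalized tables without signalling. -/
structure IsNoSignalling (P : Corr) : Prop where
  nonneg : ∀ a b x y, 0 ≤ P a b x y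
  sum_eq_one : ∀ x y, P 0 0 x y + P 0 1 x y + P 1 0 x y + P 1 1 x y = 1
  left : ∀ a x, P a 0 x 0 + P a 1 x 0 = P a 0 x 1 + P a 1 x 1
  right : ∀ b y, P 0 b 0 y + P 1 b 0 y = P 0 b 1 y + P 1 b 1 y

theorem IsNoSignalling.mem_localSet_of_le {P : Corr} (hP : IsNoSignalling P)
    (h0 : P 0 0 0 0 = 0) (h1 : P 1 1 1 0 = 0) (hle : ∀ b, P 0 b 0 1 ≤ P 0 b 1 1) :
    P ∈ localSet := by
  obtain ⟨hn, hs, hl, hr⟩ := hP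
  have s00 := hs 0 0
  have s01 := hs 0 1
  have s10 := hs 1 0
  have s11 := hs 1 1
  have l00 := hl 0 0
  have l01 := hl 0 1
  have l10 := hl 1 0
  have l11 := hl 1 1
  have r00 := hr 0 0
  have r01 := hr 0 1
  have r10 := hr 1 0
  have r11 := hr 1 1
  have e0 := hle 0
  have e1 := hle 1
  -- Eight strategies respect both zeros. Entries of P fix the weights of those with f = (0,0) or
  -- (1,1); f = (1,0) leaves a 2×2 table over (g 0, g 1) with known margins, and m is its corner,
  -- taken as large as possible.
  obtain ⟨m, hm0, hm1, hm2, hm3⟩ : ∃ m, 0 ≤ m ∧ m ≤ P 0 0 1 1 - P 0 0 0 1 ∧ m ≤ P 0 0 1 0 ∧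
      P 0 0 1 1 - P 0 0 0 1 - m ≤ 1 - P 0 1 0 0 - (P 1 0 1 0 + P 0 0 1 0) := by
    refine ⟨min (P 0 0 1 1 - P 0 0 0 1) (P 0 0 1 0), ?_, min_le_left _ _, min_le_right _ _, ?_⟩
    · exact le_min (by linarith) (hn _ _ _ _)
    · rcases min_choice (P 0 0 1 1 - P 0 0 0 1) (P 0 0 1 0) with h | h <;> rw [h]
      · linarith [hn 1 1 0 0]
      · linarith
  refine mem_localSet_of_sum
    ![P 0 0 0 1, P 0 1 0 1, P 1 0 1 1, P 1 1 1 1, m, P 0 0 1 0 - m,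
      P 0 0 1 1 - P 0 0 0 1 - m,
      1 - P 0 1 0 0 - (P 1 0 1 0 + P 0 0 1 0) - (P 0 0 1 1 - P 0 0 0 1 - m)]
    ![![0, 0], ![0, 0], ![1, 1], ![1, 1], ![1, 0], ![1, 0], ![1, 0], ![1, 0]]
    ![![1, 0], ![1, 1], ![0, 0], ![0, 1], ![0, 0], ![0, 1], ![1, 0], ![1, 1]] ?_ ?_ ?_
  · intro i
    fin_cases i <;> simp [hn] <;> linarith
  · simp [Fin.sum_univ_succ]
    linarith
  · intro a b x y
    fin_cases a <;> fin_cases b <;> fin_cases x <;> fin_cases y <;>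
      simp [Fin.sum_univ_succ, localDeterministic] <;> linarith

theorem IsNoSignalling.mem_localSet_of_le_of_le {P : Corr} (hP : IsNoSignalling P)
    (h0 : P 0 0 0 0 = 0) (h1 : P 1 0 1 1 = 0) (hle : P 0 0 0 1 ≤ P 0 1 1 0)
    (hle' : P 1 0 1 0 ≤ P 1 1 0 1) : P ∈ localSet := by
  obtain ⟨hn, hs, hl, hr⟩ := hP
  have s00 := hs 0 0
  have s01 := hs 0 1
  have s10 := hs 1 0
  have s11 := hs 1 1
  have l00 := hl 0 0
  have l01 := hl 0 1
  have l10 := hl 1 0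
  have l11 := hl 1 1
  have r00 := hr 0 0
  have r01 := hr 0 1
  have r10 := hr 1 0
  have r11 := hr 1 1
  -- Nine strategies respect both zeros; their weights are determined up to two parameters: m for f
  -- = (0,1), and k for f = (1,0), g = (0,0). Both are taken maximal.
  obtain ⟨m, hm0, hm1, hm2, hm⟩ : ∃ m, 0 ≤ m ∧ m ≤ P 0 1 0 1 ∧ m ≤ P 1 1 1 0 ∧
      (m = P 0 1 0 1 ∨ m = P 1 1 1 0) :=
    ⟨_, le_min (hn _ _ _ _) (hn _ _ _ _), min_le_left _ _, min_le_right _ _, min_choice _ _⟩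
  obtain ⟨k, hk0, hk1, hk2, hk⟩ : ∃ k, 0 ≤ k ∧ k ≤ P 0 0 1 0 ∧ k ≤ P 1 0 0 1 ∧
      (k = P 0 0 1 0 ∨ k = P 1 0 0 1) :=
    ⟨_, le_min (hn _ _ _ _) (hn _ _ _ _), min_le_left _ _, min_le_right _ _, min_choice _ _⟩
  refine mem_localSet_of_sum
    ![P 0 0 0 1, P 1 0 1 0, m, P 0 1 0 1 - m, P 1 1 1 0 - m, k, P 0 0 1 0 - k, P 1 0 0 1 - k,
      1 - P 0 0 0 1 - P 1 0 1 0 - (P 0 1 0 1 + P 1 1 1 0 - m) - (P 0 0 1 0 + P 1 0 0 1 - k)]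
    ![![0, 0], ![1, 1], ![0, 1], ![0, 0], ![1, 1], ![1, 0], ![1, 0], ![1, 0], ![1, 0]]
    ![![1, 0], ![0, 1], ![1, 1], ![1, 1], ![1, 1], ![0, 0], ![0, 1], ![1, 0], ![1, 1]] ?_ ?_ ?_
  -- Of the four cases, the two mixed ones need `hle` and `hle'`; the other two follow from
  -- nonnegativity.
  · have h9 : 0 ≤ 1 - P 0 0 0 1 - P 1 0 1 0 - (P 0 1 0 1 + P 1 1 1 0 - m) -
        (P 0 0 1 0 + P 1 0 0 1 - k) := by
      rcases hm with rfl | rfl <;> rcases hk with rfl | rfl <;>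
        linarith [hn 1 1 0 0, hn 0 1 1 1]
    intro i
    fin_cases i <;> simp [hn] <;> linarith
  · simp [Fin.sum_univ_succ]
    linarith
  · intro a b x y
    fin_cases a <;> fin_cases b <;> fin_cases x <;> fin_cases y <;>
      simp [Fin.sum_univ_succ, localDeterministic] <;> linarith

/-! ### Traces and products of positive matrices -/

open Matrix
open scoped MatrixOrder Matrix.Norms.L2Operator

variable {n : Type*} [Fintype n] [DecidableEq n] {X Y X' Y' : Matrix n n ℂ}

theorem trace_mul_nonneg (hX : X.PosSemidef) (hY : Y.PosSemidef) : 0 ≤ (X * Y).trace := by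
  obtain ⟨B, rfl⟩ := CStarAlgebra.nonneg_iff_eq_star_mul_self.mp hY.nonneg
  rw [← mul_assoc, trace_mul_comm, ← mul_assoc]
  exact (hX.mul_mul_conjTranspose_same B).trace_nonneg

theorem trace_mul_le_of_posSemidef_sub (h : (X' - X).PosSemidef) (hY : Y.PosSemidef) :
    (X * Y).trace ≤ (X' * Y).trace := by
  have := trace_mul_nonneg h hY
  rwa [sub_mul, trace_sub, sub_nonneg] at this

/-- With X = A*A and Y = B*B, tr(XY) is the squared Hilbert–Schmidt norm of AB*. -/
theorem mul_eq_zero_of_trace_mul_eq_zero (hX : X.PosSemidef) (hY : Y.PosSemidef)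
    (h : (X * Y).trace = 0) : X * Y = 0 := by
  obtain ⟨A, rfl⟩ := CStarAlgebra.nonneg_iff_eq_star_mul_self.mp hX.nonneg
  obtain ⟨B, rfl⟩ := CStarAlgebra.nonneg_iff_eq_star_mul_self.mp hY.nonneg
  have h0 : A * star B = 0 := by
    rw [← trace_mul_conjTranspose_self_eq_zero_iff, ← h, trace_mul_comm,
      conjTranspose_mul, trace_mul_comm]
    simp only [star_eq_conjTranspose, conjTranspose_conjTranspose, ← mul_assoc]
    rw [trace_mul_comm]
    simp only [mul_assoc]
  rw [mul_assoc, ← mul_assoc A, h0, zero_mul, mul_zero]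

/-- Taking adjoints, X and Y commute, so X' - Y = X'Y' is a product of commuting positive matrices.
-/
theorem posSemidef_sub_of_mul_eq_zero (hX : X.PosSemidef) (hY : Y.PosSemidef)
    (hX' : X'.PosSemidef) (hY' : Y'.PosSemidef) (hXX' : X + X' = 1) (hYY' : Y + Y' = 1)
    (h : X * Y = 0) : (X' - Y).PosSemidef := by
  have h' : Y * X = 0 := by
    simpa [hX.1.eq, hY.1.eq] using congrArg conjTranspose h
  obtain rfl := eq_sub_of_add_eq' hXX'
  obtain rfl := eq_sub_of_add_eq' hYY'
  have hc : Commute (1 - X) (1 - Y) := by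
    simp [Commute, SemiconjBy, mul_sub, sub_mul, h, h', sub_right_comm]
  have he : 1 - X - Y = (1 - X) * (1 - Y) := by
    simp [mul_sub, sub_mul, h]
  rw [he]
  exact nonneg_iff_posSemidef.mp (hc.mul_nonneg hX'.nonneg hY'.nonneg)

/-! ### Tracial form of maximally entangled correlations -/

theorem trace_kronecker_mul_maxEntangledState {d : ℕ} (A B : Matrix (Fin d) (Fin d) ℂ) :
    ((A ⊗ₖ B) * maxEntangledState d).trace = (d : ℂ)⁻¹ * (A * Bᵀ).trace := by
  have hd : (((√(d : ℝ))⁻¹ : ℝ) : ℂ) * (((√(d : ℝ))⁻¹ : ℝ) : ℂ) = (d : ℂ)⁻¹ := by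
    rw [← Complex.ofReal_mul, ← mul_inv, Real.mul_self_sqrt d.cast_nonneg]
    simp
  simp only [trace, diag_apply, mul_apply, maxEntangledState, vecMulVec_apply, Pi.star_apply,
    maxEntangledVec, Fintype.sum_prod_type, kroneckerMap_apply, transpose_apply, one_div]
  simp only [← hd, Finset.mul_sum]
  refine Finset.sum_congr rfl fun i _ => ?_
  rw [Finset.sum_eq_single i (fun j _ hj => by simp [hj.symm]) (by simp)]
  refine Finset.sum_congr rfl fun j _ => ?_
  rw [Finset.sum_eq_single j (fun k _ hk => by simp [hk.symm]) (by simp)]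
  simp only [if_true, Complex.star_def, Complex.conj_ofReal]
  ring

theorem sum_eq_of_isMatrixPOVM {d : ℕ} {E : Fin 2 → Fin 2 → Matrix (Fin d) (Fin d) ℂ}
    (hE : IsMatrixPOVM E) (x : Fin 2) : E x 0 + E x 1 = 1 := by
  simpa [Fin.sum_univ_two] using hE.2 x

/-- Correlations of the form `P(a,b|x,y) = tr (E_{a|x} G_{b|y}) / d` for POVMs on `ℂ^d`. -/
def IsTracial (d : ℕ) (E G : Fin 2 → Fin 2 → Matrix (Fin d) (Fin d) ℂ) (P : Corr) : Prop :=
  IsMatrixPOVM E ∧ IsMatrixPOVM G ∧ ∀ a b x y, (P a b x y : ℂ) = (d : ℂ)⁻¹ * (E x a * G y b).trace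

theorem IsMatrixPOVM.transpose {d : ℕ} {E : Fin 2 → Fin 2 → Matrix (Fin d) (Fin d) ℂ}
    (hE : IsMatrixPOVM E) : IsMatrixPOVM fun x a => (E x a)ᵀ :=
  ⟨fun x a => (hE.1 x a).transpose, fun x => by rw [← transpose_sum, hE.2, transpose_one]⟩

theorem mem_maxEntangledCorr_iff {d : ℕ} {P : Corr} :
    P ∈ maxEntangledCorr d ↔ ∃ E G, IsTracial d E G P := by
  constructor
  · rintro ⟨E, F, hE, hF, h⟩
    exact ⟨E, fun y b => (F y b)ᵀ, hE, hF.transpose, fun a b x y => by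
      rw [h, trace_kronecker_mul_maxEntangledState]⟩
  · rintro ⟨E, G, hE, hG, h⟩
    exact ⟨E, fun y b => (G y b)ᵀ, hE, hG.transpose, fun a b x y => by
      rw [h, trace_kronecker_mul_maxEntangledState, transpose_transpose]⟩

namespace IsTracial

variable {d : ℕ} {E G : Fin 2 → Fin 2 → Matrix (Fin d) (Fin d) ℂ} {P : Corr}

theorem isNoSignalling (h : IsTracial d E G P) (hd : d ≠ 0) : IsNoSignalling P := by
  obtain ⟨hE, hG, hP⟩ := h
  have hd' : (d : ℂ) ≠ 0 := Nat.cast_ne_zero.mpr hd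
  refine ⟨fun a b x y => ?_, fun x y => ?_, fun a x => ?_, fun b y => ?_⟩
  · rw [← Complex.zero_le_real, hP]
    exact mul_nonneg (by simp) (trace_mul_nonneg (hE.1 x a) (hG.1 y b))
  · rw [← Complex.ofReal_inj]
    push_cast
    simp only [hP, ← mul_add, ← trace_add, add_assoc, ← add_mul, sum_eq_of_isMatrixPOVM hE,
      sum_eq_of_isMatrixPOVM hG]
    simp [hd']
  · rw [← Complex.ofReal_inj]
    push_cast
    simp only [hP, ← mul_add, ← trace_add, sum_eq_of_isMatrixPOVM hG]
  · rw [← Complex.ofReal_inj]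
    push_cast
    simp only [hP, ← mul_add, ← trace_add, ← add_mul, sum_eq_of_isMatrixPOVM hE]

theorem le_of_trace_le (h : IsTracial d E G P) {a b x y a' b' x' y' : Fin 2}
    (hle : (E x a * G y b).trace ≤ (E x' a' * G y' b').trace) : P a b x y ≤ P a' b' x' y' := by
  rw [← Complex.real_le_real, h.2.2, h.2.2]
  exact mul_le_mul_of_nonneg_left hle (by simp)

theorem mul_eq_zero (h : IsTracial d E G P) (hd : d ≠ 0) {a b x y : Fin 2}
    (h0 : P a b x y = 0) : E x a * G y b = 0 := by
  refine mul_eq_zero_of_trace_mul_eq_zero (h.1.1 x a) (h.2.1.1 y b) ?_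
  have := h.2.2 a b x y
  simpa [h0, hd] using this.symm

theorem mul_eq_zero' (h : IsTracial d E G P) (hd : d ≠ 0) {a b x y : Fin 2}
    (h0 : P a b x y = 0) : G y b * E x a = 0 := by
  refine mul_eq_zero_of_trace_mul_eq_zero (h.2.1.1 y b) (h.1.1 x a) ?_
  rw [trace_mul_comm, h.mul_eq_zero hd h0, trace_zero]

theorem mem_localSet_of_zeros_b (h : IsTracial d E G P) (hd : d ≠ 0)
    (h0 : P 0 0 0 0 = 0) (h1 : P 1 1 1 0 = 0) : P ∈ localSet := by
  refine (h.isNoSignalling hd).mem_localSet_of_le h0 h1 fun b => h.le_of_trace_le ?_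
  have hE0 := sum_eq_of_isMatrixPOVM h.1 0
  have hE1 := sum_eq_of_isMatrixPOVM h.1 1
  have hG0 := sum_eq_of_isMatrixPOVM h.2.1 0
  -- The projective-like relation E 1 1 = G 0 0 * E 1 1 lets `G 0 0` be inserted between Alice's two
  -- effects. The result gives E 0 0 ≤ E 1 0.
  have hEE : E 0 0 * E 1 1 = 0 := by
    have hz : E 1 1 = G 0 0 * E 1 1 := by
      rw [eq_sub_of_add_eq hG0, sub_mul, h.mul_eq_zero' hd h1, one_mul, sub_zero]
    rw [hz, ← mul_assoc, h.mul_eq_zero hd h0, zero_mul]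
  exact trace_mul_le_of_posSemidef_sub (posSemidef_sub_of_mul_eq_zero (h.1.1 1 1) (h.1.1 0 0)
    (h.1.1 1 0) (h.1.1 0 1) (by rw [add_comm, hE1]) hE0
    (by simpa [(h.1.1 0 0).1.eq, (h.1.1 1 1).1.eq] using congrArg conjTranspose hEE)) (h.2.1.1 1 b)

theorem mem_localSet_of_zeros_c (h : IsTracial d E G P) (hd : d ≠ 0)
    (h0 : P 0 0 0 0 = 0) (h1 : P 1 0 1 1 = 0) : P ∈ localSet := by
  have hE0 := sum_eq_of_isMatrixPOVM h.1 0
  have hE1 := sum_eq_of_isMatrixPOVM h.1 1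
  have hG0 := sum_eq_of_isMatrixPOVM h.2.1 0
  have hG1 := sum_eq_of_isMatrixPOVM h.2.1 1
  have hEG0 := h.mul_eq_zero hd h0
  have hEG1 := h.mul_eq_zero hd h1
  have hGE0 := h.mul_eq_zero' hd h0
  have hGE1 := h.mul_eq_zero' hd h1
  have pE := h.1.1
  have pG := h.2.1.1
  refine (h.isNoSignalling hd).mem_localSet_of_le_of_le h0 h1
    (h.le_of_trace_le ?_) (h.le_of_trace_le ?_)
  -- The zeros give E 0 0 ≤ G 0 1 and G 1 0 ≤ E 1 0; the middle term, a trace of two of Bob's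
  -- effects, is not an entry of P.
  · calc (E 0 0 * G 1 0).trace ≤ (G 0 1 * G 1 0).trace :=
          trace_mul_le_of_posSemidef_sub (posSemidef_sub_of_mul_eq_zero (pG 0 0) (pE 0 0)
            (pG 0 1) (pE 0 1) hG0 hE0 hGE0) (pG 1 0)
      _ = (G 1 0 * G 0 1).trace := trace_mul_comm _ _
      _ ≤ (E 1 0 * G 0 1).trace :=
          trace_mul_le_of_posSemidef_sub (posSemidef_sub_of_mul_eq_zero (pE 1 1) (pG 1 0)
            (pE 1 0) (pG 1 1) (by rw [add_comm, hE1]) hG1 hEG1) (pG 0 1)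
  · calc (E 1 1 * G 0 0).trace ≤ (G 1 1 * G 0 0).trace :=
          trace_mul_le_of_posSemidef_sub (posSemidef_sub_of_mul_eq_zero (pG 1 0) (pE 1 1)
            (pG 1 1) (pE 1 0) hG1 (by rw [add_comm, hE1]) hGE1) (pG 0 0)
      _ = (G 0 0 * G 1 1).trace := trace_mul_comm _ _
      _ ≤ (E 0 1 * G 1 1).trace :=
          trace_mul_le_of_posSemidef_sub (posSemidef_sub_of_mul_eq_zero (pE 0 0) (pG 0 0)
            (pE 0 1) (pG 0 1) hE0 hG0 hEG0) (pG 1 1)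

end IsTracial

/-! ### Relabelings -/

theorem IsMatrixPOVM.relabel {d : ℕ} {E : Fin 2 → Fin 2 → Matrix (Fin d) (Fin d) ℂ}
    (hE : IsMatrixPOVM E) (σ : Equiv.Perm (Fin 2)) (τ : Fin 2 → Equiv.Perm (Fin 2)) :
    IsMatrixPOVM fun x a => E (σ x) (τ x a) :=
  ⟨fun _ _ => hE.1 _ _, fun x => by rw [Equiv.sum_comp (τ x) (E (σ x)), hE.2]⟩

theorem Relabeling.apply_mem_maxEntangledCorr (r : Relabeling) {d : ℕ} {P : Corr}
    (hP : P ∈ maxEntangledCorr d) : r.apply P ∈ maxEntangledCorr d := by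
  rw [mem_maxEntangledCorr_iff] at *
  obtain ⟨E, G, hE, hG, h⟩ := hP
  rcases r with ⟨_ | _, σ, ρ, τ, υ⟩
  · exact ⟨_, _, hE.relabel σ τ, hG.relabel ρ υ, fun a b x y => by simp [Relabeling.apply, h]⟩
  · exact ⟨_, _, hG.relabel σ τ, hE.relabel ρ υ, fun a b x y => by
      rw [trace_mul_comm]
      simp [Relabeling.apply, h]⟩

/-- Relabeling as a linear map. -/
def Relabeling.applyₗ (r : Relabeling) : Corr →ₗ[ℝ] Corr where
  toFun := r.apply
  map_add' P Q := by
    funext a b x y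
    simp only [Relabeling.apply, Pi.add_apply]
    split_ifs <;> rfl
  map_smul' c P := by
    funext a b x y
    simp only [Relabeling.apply, Pi.smul_apply, RingHom.id_apply]
    split_ifs <;> rfl

theorem Relabeling.apply_injective (r : Relabeling) : Function.Injective r.apply := by
  intro P Q h
  funext a b x y
  rcases r with ⟨_ | _, σ, ρ, τ, υ⟩
  · have := congrFun₂ (congrFun₂ h ((τ (σ.symm x)).symm a) ((υ (ρ.symm y)).symm b))
      (σ.symm x) (ρ.symm y)
    simpa [Relabeling.apply] using this
  · have := congrFun₂ (congrFun₂ h ((τ (σ.symm y)).symm b) ((υ (ρ.symm x)).symm a))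
      (σ.symm y) (ρ.symm x)
    simpa [Relabeling.apply] using this

theorem Relabeling.exists_apply_eq_localDeterministic (r : Relabeling) (f g : Fin 2 → Fin 2) :
    ∃ f' g', r.apply (localDeterministic f' g') = localDeterministic f g := by
  rcases r with ⟨_ | _, σ, ρ, τ, υ⟩
  · refine ⟨fun z => τ (σ.symm z) (f (σ.symm z)), fun z => υ (ρ.symm z) (g (ρ.symm z)), ?_⟩
    funext a b x y
    simp [Relabeling.apply, localDeterministic]
  · refine ⟨fun z => υ (ρ.symm z) (g (ρ.symm z)), fun z => τ (σ.symm z) (f (σ.symm z)), ?_⟩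
    funext a b x y
    simp [Relabeling.apply, localDeterministic, and_comm]

theorem Relabeling.mem_localSet_of_apply_mem (r : Relabeling) {P : Corr}
    (hP : r.apply P ∈ localSet) : P ∈ localSet := by
  have hsub : localSet ⊆ r.applyₗ '' localSet := by
    refine convexHull_min ?_ ((convex_convexHull ℝ _).linear_image _)
    rintro _ ⟨⟨f, g⟩, rfl⟩
    obtain ⟨f', g', h⟩ := r.exists_apply_eq_localDeterministic f g
    exact ⟨_, subset_convexHull ℝ _ ⟨(f', g'), rfl⟩, h⟩
  obtain ⟨Q, hQ, h⟩ := hsub hP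
  rwa [← r.apply_injective h]

/-! ### Convex mixtures -/

/-- The zero set of a nonnegative functional is a face: every point of positive weight in a mixture
lying there lies there too. -/
theorem mem_of_mem_convexHull_of_apply_eq_zero {V : Type*} [AddCommGroup V] [Module ℝ V]
    {s t : Set V} (ht : Convex ℝ t) (l : V →ₗ[ℝ] ℝ) (hs : ∀ v ∈ s, 0 ≤ l v)
    (hst : ∀ v ∈ s, l v = 0 → v ∈ t) {v : V} (hv : v ∈ convexHull ℝ s) (h0 : l v = 0) :
    v ∈ t := by
  have hc : Convex ℝ {v | 0 ≤ l v ∧ (l v = 0 → v ∈ t)} := by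
    rw [convex_iff_forall_pos]
    rintro u ⟨hu, hu'⟩ w ⟨hw, hw'⟩ α β hα hβ hαβ
    have hlu := mul_nonneg hα.le hu
    have hlw := mul_nonneg hβ.le hw
    have hl : l (α • u + β • w) = α * l u + β * l w := by simp
    refine ⟨hl ▸ add_nonneg hlu hlw, fun h => ?_⟩
    rw [hl, add_eq_zero_iff_of_nonneg hlu hlw] at h
    exact ht (hu' (by simpa [hα.ne'] using h.1)) (hw' (by simpa [hβ.ne'] using h.2))
      hα.le hβ.le hαβ
  have hsub : s ⊆ {v | 0 ≤ l v ∧ (l v = 0 → v ∈ t)} := fun v hv => ⟨hs v hv, hst v hv⟩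
  exact (convexHull_min hsub hc hv).2 h0

theorem maxEntangledSet_eq :
    maxEntangledSet = convexHull ℝ (⋃ d ∈ Set.Ici (2 : ℕ), maxEntangledCorr d) := by
  refine (convexHull_min ?_ (convex_convexHull ℝ _)).antisymm
    (convexHull_mono (Set.iUnion₂_mono fun d _ => subset_convexHull ℝ _))
  exact Set.iUnion₂_subset fun d hd => convexHull_mono (Set.subset_biUnion_of_mem hd)

/-- The entry `P(a,b|x,y)` as a linear functional. -/
def entry (a b x y : Fin 2) : Corr →ₗ[ℝ] ℝ where
  toFun P := P a b x y
  map_add' _ _ := rfl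
  map_smul' _ _ := rfl

/-- If two zeros make every tracial correlation local, they do so, after any relabeling, for
every convex mixture of such correlations. -/
theorem mem_localSet_of_relabeling_zeros {a b x y a' b' x' y' : Fin 2}
    (hloc : ∀ d ≠ 0, ∀ E G P, IsTracial d E G P → P a b x y = 0 → P a' b' x' y' = 0 →
      P ∈ localSet)
    (r : Relabeling) {P : Corr} (hP : P ∈ maxEntangledSet)
    (h0 : r.apply P a b x y = 0) (h1 : r.apply P a' b' x' y' = 0) : P ∈ localSet := by
  rw [maxEntangledSet_eq] at hP
  have key : ∀ Q ∈ ⋃ d ∈ Set.Ici (2 : ℕ), maxEntangledCorr d,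
      ∃ d ≠ 0, ∃ E G, IsTracial d E G (r.apply Q) := by
    intro Q hQ
    obtain ⟨d, hd, hQ⟩ := Set.mem_iUnion₂.mp hQ
    exact ⟨d, (zero_lt_two.trans_le hd).ne',
      mem_maxEntangledCorr_iff.mp (r.apply_mem_maxEntangledCorr hQ)⟩
  refine mem_of_mem_convexHull_of_apply_eq_zero (convex_convexHull ℝ _)
    -- Both entries are nonnegative, so one functional, their sum, encodes both zeros.
    ((entry a b x y + entry a' b' x' y') ∘ₗ r.applyₗ) (fun Q hQ => ?_) (fun Q hQ hl => ?_) hP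
    (show r.apply P a b x y + r.apply P a' b' x' y' = 0 by rw [h0, h1, add_zero])
  · obtain ⟨d, hd, E, G, h⟩ := key Q hQ
    have hn := (h.isNoSignalling hd).nonneg
    exact add_nonneg (hn a b x y) (hn a' b' x' y')
  · obtain ⟨d, hd, E, G, h⟩ := key Q hQ
    have hn := (h.isNoSignalling hd).nonneg
    obtain ⟨z0, z1⟩ := (add_eq_zero_iff_of_nonneg (hn a b x y) (hn a' b' x' y')).mp hl
    exact r.mem_localSet_of_apply_mem (hloc d hd E G _ h z0 z1)

end CHSH

theorem mainTheorem7 :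
    (∀ P ∈ CHSH.upToRelabeling CHSH.Q2b, P ∉ CHSH.localSet → P ∉ CHSH.maxEntangledSet) ∧
    (∀ P ∈ CHSH.upToRelabeling CHSH.Q2c, P ∉ CHSH.localSet → P ∉ CHSH.maxEntangledSet) ∧
    (∀ P ∈ CHSH.upToRelabeling CHSH.Q3a, P ∉ CHSH.localSet → P ∉ CHSH.maxEntangledSet) ∧
    (∀ P ∈ CHSH.upToRelabeling CHSH.Q3b, P ∉ CHSH.localSet → P ∉ CHSH.maxEntangledSet) := by
  have hb : ∀ P (r : CHSH.Relabeling), r.apply P 0 0 0 0 = 0 → r.apply P 1 1 1 0 = 0 →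
      P ∉ CHSH.localSet → P ∉ CHSH.maxEntangledSet := fun P r h0 h1 hP hM =>
    hP (CHSH.mem_localSet_of_relabeling_zeros
      (fun _ hd _ _ _ h => h.mem_localSet_of_zeros_b hd) r hM h0 h1)
  have hc : ∀ P (r : CHSH.Relabeling), r.apply P 0 0 0 0 = 0 → r.apply P 1 0 1 1 = 0 →
      P ∉ CHSH.localSet → P ∉ CHSH.maxEntangledSet := fun P r h0 h1 hP hM =>
    hP (CHSH.mem_localSet_of_relabeling_zeros
      (fun _ hd _ _ _ h => h.mem_localSet_of_zeros_c hd) r hM h0 h1)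
  refine ⟨?_, ?_, ?_, ?_⟩
  · rintro P ⟨r, -, h0, h1⟩
    exact hb P r h0 h1
  · rintro P ⟨r, -, h0, h1⟩
    exact hc P r h0 h1
  · rintro P ⟨r, -, h0, h1, -⟩
    exact hb P r h0 h1
  · rintro P ⟨r, -, h0, -, h1⟩
    exact hc P r h0 h1
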